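/- Let $d\ge 1$ be an integer, $0<\beta\le 1$, $C>0$ and $M>0$. Let $\mathcal F$ be the class of functions $m:\mathbb R^d\to\mathbb R$ with $|m(x)-m(x')|\le C\|x-x'\|^\beta$ for all $x,x'\in\mathbb R^d$ (Euclidean norm), with support contained in $[0,1]^d$, and with $|m|\le M$. For $m\in\mathcal F$ let $(X_1,Y_1),\dots,(X_n,Y_n)$ be i.i.d. copies of $(X,Y)$, where $Y=m(X)+\eta$, $X$ is uniform on $[0,1]^d$, and $\eta$ is uniform on $[-1/2,1/2]$ and independent of $X$. A (sequentially interactive) privacy mechanism consists of measurable spaces $\mathcal Z_1,\dots,\mathcal Z_n$ and Markov kernels $Q_i(\,\cdot\mid (x,y),z_1,\dots,z_{i-1})$ from $(\mathbb R^d\times\mathbb R)\times\mathcal Z_1\times\dots\times\mathcal Z_{i-1}$ to $\mathcal Z_i$. The private datum $Z_i$ is drawn from $Q_i(\,\cdot\mid (X_i,Y_i),Z_1,\dots,Z_{i-1})$. For $\alpha\in[0,\infty]$, let $\mathcal Q_\alpha$ be the set of those mechanisms that are $\alpha$-locally differentially private, i.e. $$\frac{Q_i(A\mid (x,y),z_1,\dots,z_{i-1})}{Q_i(A\mid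 (x',y'),z_1,\dots,z_{i-1})}\le e^\alpha$$ for all $i\le n$, all measurable $A\subseteq\mathcal Z_i$, all $z_j\in\mathcal Z_j$ ($j<i$), and all potential values $(x,y),(x',y')$ of the raw data, that is, points with $x\in[0,1]^d$ and $|y-m(x)|\le 1/2$ for some $m\in\mathcal F$ (and likewise for $(x',y')$). Here $0/0=0$ and $a/0=\infty$ for $a>0$. Then there is a constant $c>0$, depending only on $d,\beta,C,M$, such that for all $n\ge 1$ and all $\alpha\in[0,\infty]$, $$\inf_{\tilde m,\;Q\in\mathcal Q_\alpha}\ \sup_{m\in\mathcal F}\ \mathbb E\left[\int_{[0,1]^d}(\tilde m(x)-m(x))^2\,dx\right]\ \ge\ c\,\Big(\big(n(e^\alpha-1)^2\big)^{-\beta/(\beta+d)}\wedge 1\Big),$$ where the infimum is over all mechanisms $Q\in\mathcal Q_\alpha$ and all estimators $\tilde m=\tilde m(x;Z_1,\dots,Z_n)$, jointly measurable in $x$ and the private sample, and where $0^{-\beta/(\beta+d)}=\infty$ and $\infty^{-\beta/(\beta+d)}=0$. -/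

import Mathlib

open MeasureTheory ProbabilityTheory
open scoped ENNReal

universe u

noncomputable section

namespace PrivateRegression

/-- The covariate space `ℝ^d` with its Euclidean norm and Lebesgue measure. -/
abbrev Point (d : ℕ) : Type := EuclideanSpace ℝ (Fin d)

/-- The unit cube `[0,1]^d`. -/
def unitCube (d : ℕ) : Set (Point d) := {x | ∀ i, x i ∈ Set.Icc (0 : ℝ) 1}

/-- The regression functions `m : ℝ^d → ℝ` that are `(β, C)`-Hölder on `ℝ^d`, supported in
`[0,1]^d` and bounded by `M`. -/
def holderClass (d : ℕ) (β C M : ℝ) : Set (Point d → ℝ) :=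
  {m | (∀ x x', |m x - m x'| ≤ C * ‖x - x'‖ ^ β) ∧
    Function.support m ⊆ unitCube d ∧ ∀ x, |m x| ≤ M}

/-- The uniform distribution on `[0,1]^d` (the cube has volume one). -/
def designLaw (d : ℕ) : Measure (Point d) := volume.restrict (unitCube d)

/-- The uniform distribution on `[-1/2, 1/2]`. -/
def noiseLaw : Measure ℝ := volume.restrict (Set.Icc (-1 / 2) (1 / 2))

/-- The law of one raw observation `(X, Y)`, where `Y = m X + η`, `X` is uniform on the cube and
`η` is uniform on `[-1/2, 1/2]` and independent of `X`. -/
def rawLaw {d : ℕ} (m : Point d → ℝ) : Measure (Point d × ℝ) :=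
  ((designLaw d).prod noiseLaw).map (fun w => (w.1, m w.1 + w.2))

/-- The potential values `(x, y)` of a raw observation: `x` lies in the cube, and `y` is at
distance at most `1/2` from `m x` for some admissible regression function `m`. -/
def potentialValues (d : ℕ) (β C M : ℝ) : Set (Point d × ℝ) :=
  {p | p.1 ∈ unitCube d ∧ ∃ m ∈ holderClass d β C M, |p.2 - m p.1| ≤ 1 / 2}

/-- `History Z k` is the space of the first `k` privatized data `(z_0, …, z_{k-1})`,
`z_j ∈ Z j`, that is, the product `Z 0 × ⋯ × Z (k-1)`. -/
def History (Z : ℕ → Type u) : ℕ → Type u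
  | 0 => PUnit
  | k + 1 => History Z k × Z k

/-- The product σ-algebra on the space of histories. -/
instance History.instMeasurableSpace (Z : ℕ → Type u) [∀ k, MeasurableSpace (Z k)] :
    ∀ k, MeasurableSpace (History Z k)
  | 0 => inferInstanceAs (MeasurableSpace PUnit)
  | k + 1 =>
    @Prod.instMeasurableSpace (History Z k) (Z k) (History.instMeasurableSpace Z k) inferInstance

/-- A sequentially interactive privacy mechanism for raw data in `ℝ^d × ℝ`. Its `k`-th datum takes
values in an arbitrary measurable space `Out k` and is drawn from the probability measure
`kernel k ((x, y), (z_0, …, z_{k-1}))`, where `(x, y)` is the `k`-th raw datum and the `z_j` are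
the previously released data. With a sample of size `n` only the indices `k < n` play a role. -/
structure Mechanism (d : ℕ) : Type (u + 1) where
  Out : ℕ → Type u
  instMeasurableSpaceOut : ∀ k, MeasurableSpace (Out k)
  kernel : ∀ k, Kernel ((Point d × ℝ) × History Out k) (Out k)
  isMarkovKernel : ∀ k, IsMarkovKernel (kernel k)

attribute [instance] Mechanism.instMeasurableSpaceOut Mechanism.isMarkovKernel

namespace Mechanism

variable {d : ℕ}

/-- `α`-local differential privacy of the first `n` releases, `α ∈ [0, ∞]`, for raw data with
potential values in `D`. The ratio is taken in `[0, ∞]`, with `0 / 0 = 0` and `a / 0 = ∞` for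
`a > 0`. -/
def IsLDP (Q : Mechanism.{u} d) (D : Set (Point d × ℝ)) (n : ℕ) (α : ℝ≥0∞) : Prop :=
  ∀ k < n, ∀ p ∈ D, ∀ p' ∈ D, ∀ z : History Q.Out k, ∀ A : Set (Q.Out k), MeasurableSet A →
    Q.kernel k (p, z) A / Q.kernel k (p', z) A ≤ EReal.exp (α : EReal)

/-- The law of the private sample `(Z_0, …, Z_{n-1})` when the raw data are i.i.d. with law `P`:
at step `k` a raw datum is drawn from `P` independently of the history, then `Z_k` is drawn from
`kernel k` given this raw datum and the history; `Z_k` is appended to the history and the raw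
datum is discarded. -/
def sampleLaw (Q : Mechanism.{u} d) (P : Measure (Point d × ℝ)) :
    ∀ n, Measure (History Q.Out n)
  | 0 => Measure.dirac PUnit.unit
  | k + 1 => ((P.prod (sampleLaw Q P k)) ⊗ₘ (Q.kernel k)).map (fun w => (w.1.2, w.2))

instance isProbabilityMeasure_sampleLaw (Q : Mechanism.{u} d) (P : Measure (Point d × ℝ))
    [IsProbabilityMeasure P] : ∀ n, IsProbabilityMeasure (Q.sampleLaw P n)
  | 0 => inferInstanceAs
      (IsProbabilityMeasure (Measure.dirac (PUnit.unit : PUnit.{u + 1})))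
  | k + 1 => by
    have := isProbabilityMeasure_sampleLaw Q P k
    have h : Measurable
        (fun w : ((Point d × ℝ) × History Q.Out k) × Q.Out k => (w.1.2, w.2)) := by fun_prop
    exact Measure.isProbabilityMeasure_map h.aemeasurable

/-- The mean integrated squared error `E ∫_{[0,1]^d} (m̃(x) - m(x))² dx` of the estimator `est`
based on the private sample of size `n`, when the regression function is `m`. -/
def risk (Q : Mechanism.{u} d) (n : ℕ) (est : History Q.Out n → Point d → ℝ)
    (m : Point d → ℝ) : ℝ≥0∞ :=
  ∫⁻ z, ∫⁻ x in unitCube d, ENNReal.ofReal ((est z x - m x) ^ 2) ∂volume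
    ∂(Q.sampleLaw (rawLaw m) n)

end Mechanism

/-- The private minimax risk: the infimum over all `α`-locally differentially private, possibly
sequentially interactive mechanisms and all (jointly measurable) estimators of the worst-case risk
over the Hölder class. -/
def minimaxRisk (d : ℕ) (β C M : ℝ) (n : ℕ) (α : ℝ≥0∞) : ℝ≥0∞ :=
  ⨅ (Q : Mechanism.{u} d) (_ : Q.IsLDP (potentialValues d β C M) n α)
    (est : History Q.Out n → Point d → ℝ) (_ : Measurable (Function.uncurry est)),
    ⨆ m ∈ holderClass d β C M, Q.risk n est m

end PrivateRegression

end

/-! The proof is Assouad's method on a hypercube of `k ^ d` disjoint bumps, of width about `1/k` and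
height about `k^(-β)`. Flipping one bump moves the regression function by at most `τ = k^(-(β+d))`
in L¹, and by order `k^(-2β-d)` in squared L².

Under privacy it is the L¹ distance that governs indistinguishability. For a fixed history and
event, the release probability as a function of the raw datum lies between some `q` and `e^α q`. As
the noise is uniform, passing from `m` to `m'` only shifts the interval of `Y`, and the parts gained
and lost have equal length. The averaged release probability therefore changes by a relative amount
of at most `(e^α - 1) τ` (`lintegral_rawLaw_le`).

Each round then multiplies the second moment of the likelihood ratio by at most `1 + (e^α - 1)² τ²`
(`exists_density_stepLaw`). When `n (e^α - 1)² τ² ≤ 1` it stays below 3, and neighbouring vertices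
cannot be tested against each other (`le_lintegral_add_lintegral`). Averaging over the hypercube
(`card_mul_le_of_hypercube`) gives a risk of order `k^(-2β)`, and `k` of order `(n (e^α -
1)²)^(1/(2(β+d)))` yields the rate. -/

noncomputable section

namespace PrivateRegression

/-! ### Likelihood ratios through one round of interaction. -/

section StepLaw

variable {A Z Y : Type*} [MeasurableSpace A] [MeasurableSpace Z] [MeasurableSpace Y]

/-- One round of a sequentially interactive mechanism: the history is drawn from `S`, the raw datum
from `P`, and the released datum from `κ`. -/
def stepLaw (κ : Kernel (A × Z) Y) (P : Measure A) (S : Measure Z) : Measure (Z × Y) :=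
  ((P.prod S) ⊗ₘ κ).map (fun w => (w.1.2, w.2))

theorem lintegral_stepLaw (κ : Kernel (A × Z) Y) [IsMarkovKernel κ] (P : Measure A) [SFinite P]
    (S : Measure Z) [SFinite S] {F : Z × Y → ℝ≥0∞} (hF : Measurable F) :
    ∫⁻ w, F w ∂(stepLaw κ P S) = ∫⁻ z, ∫⁻ p, ∫⁻ y, F (z, y) ∂(κ (p, z)) ∂P ∂S := by
  have hm : Measurable (fun w : (A × Z) × Y => (w.1.2, w.2)) := by fun_prop
  have hFm : Measurable (fun w : (A × Z) × Y => F (w.1.2, w.2)) := hF.comp hm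
  rw [stepLaw, lintegral_map hF hm, Measure.lintegral_compProd hFm,
    lintegral_prod_symm' _ (Measurable.lintegral_kernel_prod_right' (κ := κ) hFm)]

theorem stepLaw_apply (κ : Kernel (A × Z) Y) [IsMarkovKernel κ] (P : Measure A) [SFinite P]
    (S : Measure Z) [SFinite S] {B : Set (Z × Y)} (hB : MeasurableSet B) :
    stepLaw κ P S B = ∫⁻ z, ∫⁻ p, κ (p, z) (Prod.mk z ⁻¹' B) ∂P ∂S := by
  rw [← lintegral_indicator_one hB,
    lintegral_stepLaw κ P S (measurable_one.indicator hB)]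
  refine lintegral_congr fun z => lintegral_congr fun p => ?_
  rw [← lintegral_indicator_one (measurable_prodMk_left hB)]
  rfl

instance (κ : Kernel (A × Z) Y) [IsMarkovKernel κ] (P : Measure A) [IsProbabilityMeasure P]
    (S : Measure Z) [IsFiniteMeasure S] : IsFiniteMeasure (stepLaw κ P S) := by
  unfold stepLaw; infer_instance

theorem lintegral_fst_stepLaw (κ : Kernel (A × Z) Y) [IsMarkovKernel κ] (P : Measure A)
    [IsProbabilityMeasure P] (S : Measure Z) [SFinite S] {f : Z → ℝ≥0∞} (hf : Measurable f) :
    ∫⁻ w, f w.1 ∂(stepLaw κ P S) = ∫⁻ z, f z ∂S := by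
  have hf1 : Measurable fun w : Z × Y => f w.1 := hf.comp measurable_fst
  rw [lintegral_stepLaw κ P S hf1]
  simp

theorem measurable_lintegral_kernel (κ : Kernel (A × Z) Y) [IsMarkovKernel κ] (P : Measure A)
    [SFinite P] {F : Z × Y → ℝ≥0∞} (hF : Measurable F) :
    Measurable fun z => ∫⁻ p, ∫⁻ y, F (z, y) ∂(κ (p, z)) ∂P := by
  have hm : Measurable (fun w : (A × Z) × Y => (w.1.2, w.2)) := by fun_prop
  exact (Measurable.lintegral_kernel_prod_right' (κ := κ) (hF.comp hm)).lintegral_prod_left'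

/-- A round does not alter the history it receives, so a change of the history law carries over with
the same density. This separates the change of past from the change of raw law in the current round.
-/
theorem stepLaw_withDensity (κ : Kernel (A × Z) Y) [IsMarkovKernel κ] (P : Measure A)
    [IsProbabilityMeasure P] (S : Measure Z) [IsFiniteMeasure S] {L : Z → ℝ≥0∞}
    (hL : Measurable L) [IsFiniteMeasure (S.withDensity L)] :
    stepLaw κ P (S.withDensity L) = (stepLaw κ P S).withDensity (fun w => L w.1) := by
  ext B hB
  have hB1 : Measurable (B.indicator (1 : Z × Y → ℝ≥0∞)) := measurable_one.indicator hB
  have hL1 : Measurable fun w : Z × Y => L w.1 := hL.comp measurable_fst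
  rw [← lintegral_indicator_one hB, ← lintegral_indicator_one hB,
    lintegral_stepLaw κ P _ hB1,
    lintegral_withDensity_eq_lintegral_mul _ hL1 hB1,
    lintegral_stepLaw κ P S (hL1.mul hB1),
    lintegral_withDensity_eq_lintegral_mul _ hL (measurable_lintegral_kernel κ P hB1)]
  refine lintegral_congr fun z => ?_
  have hB2 : Measurable fun y => B.indicator (1 : Z × Y → ℝ≥0∞) (z, y) :=
    hB1.comp measurable_prodMk_left
  simp only [Pi.mul_apply]
  simp_rw [lintegral_const_mul _ hB2]
  rw [lintegral_const_mul]
  have : Measurable fun q : A × Z => ∫⁻ y, B.indicator (1 : Z × Y → ℝ≥0∞) (q.2, y) ∂(κ q) :=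
    Measurable.lintegral_kernel_prod_right' (κ := κ)
      (hB1.comp (by fun_prop : Measurable (fun w : (A × Z) × Y => (w.1.2, w.2))))
  exact this.comp measurable_prodMk_right

/-- For nearby laws the density lies within `δ` of one, almost everywhere. -/
theorem exists_density_near_one {μ ν : Measure Z} [IsFiniteMeasure μ] [IsFiniteMeasure ν]
    {δ : ℝ≥0∞} (h₁ : ∀ B, MeasurableSet B → ν B ≤ μ B + δ * μ B)
    (h₂ : ∀ B, MeasurableSet B → μ B ≤ ν B + δ * μ B) :
    ∃ r : Z → ℝ≥0∞, Measurable r ∧ ν = μ.withDensity r ∧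
      (∀ᵐ w ∂μ, r w ≤ 1 + δ) ∧ ∀ᵐ w ∂μ, 1 ≤ r w + δ := by
  have hac : ν ≪ μ := by
    refine Measure.AbsolutelyContinuous.mk fun B hB h0 => ?_
    simpa [h0] using h₁ B hB
  have hr : Measurable (ν.rnDeriv μ) := Measure.measurable_rnDeriv _ _
  have hν : μ.withDensity (ν.rnDeriv μ) = ν := Measure.withDensity_rnDeriv_eq _ _ hac
  have hset : ∀ B, MeasurableSet B → ∫⁻ w in B, ν.rnDeriv μ w ∂μ = ν B := fun B hB => by
    rw [← withDensity_apply _ hB, hν]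
  refine ⟨ν.rnDeriv μ, hr, hν.symm, ?_, ?_⟩
  · refine ae_le_of_forall_setLIntegral_le_of_sigmaFinite hr fun B hB _ => ?_
    rw [hset B hB, setLIntegral_const, add_mul, one_mul]
    exact h₁ B hB
  · refine ae_le_of_forall_setLIntegral_le_of_sigmaFinite measurable_const fun B hB _ => ?_
    rw [lintegral_add_right _ measurable_const, hset B hB, setLIntegral_const, setLIntegral_const,
      one_mul]
    exact h₂ B hB

/-- This is `(r - 1)² ≤ δ²`, arranged to avoid truncated subtraction. -/
theorem sq_add_one_le {r δ : ℝ≥0∞} (hδ : δ ≠ ∞) (h₁ : r ≤ 1 + δ) (h₂ : 1 ≤ r + δ) :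
    r ^ 2 + 1 ≤ 2 * r + δ ^ 2 := by
  have hr : r ≠ ∞ := ne_top_of_le_ne_top (by finiteness) h₁
  lift δ to NNReal using hδ
  lift r to NNReal using hr
  norm_cast at *
  rw [← NNReal.coe_le_coe] at *
  push_cast at *
  nlinarith

/-- One round of the mechanism multiplies the second moment of the likelihood ratio by at most
`1 + δ ^ 2` when the conditional laws of the released datum are within relative distance `δ`. -/
theorem exists_density_stepLaw (κ : Kernel (A × Z) Y) [IsMarkovKernel κ] (P P' : Measure A)
    [IsProbabilityMeasure P] [IsProbabilityMeasure P'] (S : Measure Z) [IsFiniteMeasure S]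
    {δ : ℝ≥0∞} (hδ : δ ≠ ∞)
    (h₁ : ∀ z, ∀ B, MeasurableSet B →
      ∫⁻ p, κ (p, z) B ∂P' ≤ ∫⁻ p, κ (p, z) B ∂P + δ * ∫⁻ p, κ (p, z) B ∂P)
    (h₂ : ∀ z, ∀ B, MeasurableSet B →
      ∫⁻ p, κ (p, z) B ∂P ≤ ∫⁻ p, κ (p, z) B ∂P' + δ * ∫⁻ p, κ (p, z) B ∂P)
    {L : Z → ℝ≥0∞} (hL : Measurable L) [IsFiniteMeasure (S.withDensity L)]
    (hfin : ∫⁻ z, L z ^ 2 ∂S ≠ ∞) :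
    ∃ L' : Z × Y → ℝ≥0∞, Measurable L' ∧
      stepLaw κ P' (S.withDensity L) = (stepLaw κ P S).withDensity L' ∧
      ∫⁻ w, L' w ^ 2 ∂(stepLaw κ P S) ≤ (1 + δ ^ 2) * ∫⁻ z, L z ^ 2 ∂S := by
  have hmeas : ∀ (P₀ : Measure A) [IsProbabilityMeasure P₀], ∀ B : Set (Z × Y), MeasurableSet B →
      Measurable fun z => ∫⁻ p, κ (p, z) (Prod.mk z ⁻¹' B) ∂P₀ := fun P₀ _ B hB => by
    have := measurable_lintegral_kernel κ P₀ (measurable_one.indicator hB)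
    convert this using 5 with z p
    rw [← lintegral_indicator_one (measurable_prodMk_left hB)]
    rfl
  -- The density is taken between joint laws with the same history law `S`, so no conditional
  -- densities are needed and the output space may be arbitrary.
  obtain ⟨r, hr, hν, hr₁, hr₂⟩ := exists_density_near_one (μ := stepLaw κ P S)
    (ν := stepLaw κ P' S) (δ := δ)
    (fun B hB => by
      rw [stepLaw_apply κ P S hB, stepLaw_apply κ P' S hB,
        ← lintegral_const_mul _ (hmeas P B hB), ← lintegral_add_left (hmeas P B hB)]
      exact lintegral_mono fun z => h₁ z _ (measurable_prodMk_left hB))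
    (fun B hB => by
      rw [stepLaw_apply κ P S hB, stepLaw_apply κ P' S hB,
        ← lintegral_const_mul _ (hmeas P B hB), ← lintegral_add_left (hmeas P' B hB)]
      exact lintegral_mono fun z => h₂ z _ (measurable_prodMk_left hB))
  have hL1 : Measurable fun w : Z × Y => L w.1 := hL.comp measurable_fst
  refine ⟨fun w => r w * L w.1, hr.mul hL1, ?_, ?_⟩
  · rw [stepLaw_withDensity κ P' S hL, hν, ← withDensity_mul _ hr hL1]
    rfl
  · set μ := stepLaw κ P S
    set I := ∫⁻ z, L z ^ 2 ∂S
    have hI : ∫⁻ w, L w.1 ^ 2 ∂μ = I := lintegral_fst_stepLaw κ P S (hL.pow_const 2)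
    -- Both joint laws have history marginal `S`, so weighting by `r` leaves integrals of functions
    -- of the history unchanged. The term linear in `r - 1` thus vanishes and only `δ ^ 2` remains.
    have hI' : ∫⁻ w, r w * L w.1 ^ 2 ∂μ = I := by
      have := lintegral_fst_stepLaw κ P' S (hL.pow_const 2)
      rw [hν, lintegral_withDensity_eq_lintegral_mul _ hr (hL1.pow_const 2)] at this
      exact this
    have key : ∫⁻ w, (r w * L w.1) ^ 2 ∂μ + I ≤ (1 + δ ^ 2) * I + I := by
      calc ∫⁻ w, (r w * L w.1) ^ 2 ∂μ + I
          = ∫⁻ w, (r w * L w.1) ^ 2 + L w.1 ^ 2 ∂μ := by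
            rw [lintegral_add_right _ (hL1.pow_const 2), hI]
        _ ≤ ∫⁻ w, 2 * (r w * L w.1 ^ 2) + δ ^ 2 * L w.1 ^ 2 ∂μ := by
            refine lintegral_mono_ae ?_
            filter_upwards [hr₁, hr₂] with w h1 h2
            calc (r w * L w.1) ^ 2 + L w.1 ^ 2 = (r w ^ 2 + 1) * L w.1 ^ 2 := by ring
              _ ≤ (2 * r w + δ ^ 2) * L w.1 ^ 2 := by exact mul_le_mul_left (sq_add_one_le hδ h1 h2) _
              _ = _ := by ring
        _ = 2 * I + δ ^ 2 * I := by
            have hrL : Measurable fun w => r w * L w.1 ^ 2 := hr.mul (hL1.pow_const 2)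
            rw [lintegral_add_right _ ((hL1.pow_const 2).const_mul _),
              lintegral_const_mul _ hrL,
              lintegral_const_mul _ (hL1.pow_const 2), hI, hI']
        _ = (1 + δ ^ 2) * I + I := by ring
    exact (ENNReal.add_le_add_iff_right hfin).1 key

end StepLaw

/-! ### Testing two private samples, and iteration over the rounds. -/

/-- A two-point testing bound in terms of the second moment of the likelihood ratio. -/
theorem le_lintegral_add_lintegral {Z : Type*} [MeasurableSpace Z] {μ : Measure Z}
    {L : Z → ℝ≥0∞} (hL : Measurable L) [IsProbabilityMeasure (μ.withDensity L)]
    (hL2 : ∫⁻ z, L z ^ 2 ∂μ ≤ 3) {f g : Z → ℝ≥0∞} (hf : Measurable f) (hg : Measurable g)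
    {Δ : ℝ≥0∞} (hfg : ∀ z, Δ ≤ f z + g z) :
    Δ ≤ 4 * (∫⁻ z, f z ∂μ + ∫⁻ z, g z ∂(μ.withDensity L)) := by
  have hL1 : ∫⁻ z, L z ∂μ = 1 := by
    rw [← setLIntegral_univ, ← withDensity_apply _ MeasurableSet.univ]
    exact measure_univ
  have hmin : 1 ≤ 4 * ∫⁻ z, min 1 (L z) ∂μ := by
    -- For `t ≥ 1` this is `(t - 2)² ≥ 0`. Integrated, it bounds the overlap of the two laws below
    -- by `(4 - 3) / 4`.
    have hpt : ∀ t : ℝ≥0∞, 4 * t ≤ 4 * min 1 t + t ^ 2 := fun t => by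
      rcases le_total t 1 with h | h
      · rw [min_eq_right h]; exact le_self_add
      · rw [min_eq_left h]
        induction t with
        | top => simp
        | coe t =>
          norm_cast
          rw [← NNReal.coe_le_coe]
          push_cast
          nlinarith [sq_nonneg ((t : ℝ) - 2)]
    have h4 : (4 : ℝ≥0∞) ≤ 4 * ∫⁻ z, min 1 (L z) ∂μ + 3 := by
      calc (4 : ℝ≥0∞) = ∫⁻ z, 4 * L z ∂μ := by rw [lintegral_const_mul _ hL, hL1, mul_one]
        _ ≤ ∫⁻ z, 4 * min 1 (L z) + L z ^ 2 ∂μ := lintegral_mono fun z => hpt _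
        _ ≤ _ := by
          rw [lintegral_add_right _ (hL.pow_const 2),
            lintegral_const_mul _ (measurable_const.min hL)]
          gcongr
    rw [show (4 : ℝ≥0∞) = 1 + 3 by norm_num] at h4
    rw [show (4 : ℝ≥0∞) = 1 + 3 by norm_num]
    exact (ENNReal.add_le_add_iff_right (by simp)).1 h4
  calc Δ ≤ Δ * (4 * ∫⁻ z, min 1 (L z) ∂μ) := le_mul_of_one_le_right' hmin
    _ = 4 * ∫⁻ z, Δ * min 1 (L z) ∂μ := by
      rw [lintegral_const_mul _ (measurable_const.min hL)]; ring
    _ ≤ 4 * ∫⁻ z, f z + L z * g z ∂μ := by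
      gcongr with z
      calc Δ * min 1 (L z) ≤ (f z + g z) * min 1 (L z) := by gcongr; exact hfg z
        _ = f z * min 1 (L z) + g z * min 1 (L z) := add_mul _ _ _
        _ ≤ f z * 1 + g z * L z := by
          gcongr
          · exact min_le_left _ _
          · exact min_le_right _ _
        _ = f z + L z * g z := by ring
    _ = _ := by
      rw [lintegral_add_left hf, lintegral_withDensity_eq_lintegral_mul _ hL hg]
      rfl

namespace Mechanism

variable {d : ℕ}

theorem sampleLaw_succ (Q : Mechanism.{u} d) (P : Measure (Point d × ℝ)) (k : ℕ) :
    Q.sampleLaw P (k + 1) = stepLaw (Q.kernel k) P (Q.sampleLaw P k) := rfl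

/-- If in every round the conditional laws of the released datum under two raw laws are within
relative distance `δ`, then the second moment of the likelihood ratio of the private samples grows
at most geometrically. -/
theorem exists_density_sampleLaw (Q : Mechanism.{u} d) (P P' : Measure (Point d × ℝ))
    [IsProbabilityMeasure P] [IsProbabilityMeasure P'] {δ : ℝ≥0∞} (hδ : δ ≠ ∞) {n : ℕ}
    (h₁ : ∀ k < n, ∀ z, ∀ B, MeasurableSet B → ∫⁻ p, Q.kernel k (p, z) B ∂P' ≤
      ∫⁻ p, Q.kernel k (p, z) B ∂P + δ * ∫⁻ p, Q.kernel k (p, z) B ∂P)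
    (h₂ : ∀ k < n, ∀ z, ∀ B, MeasurableSet B → ∫⁻ p, Q.kernel k (p, z) B ∂P ≤
      ∫⁻ p, Q.kernel k (p, z) B ∂P' + δ * ∫⁻ p, Q.kernel k (p, z) B ∂P)
    {k : ℕ} (hk : k ≤ n) :
    ∃ L : History Q.Out k → ℝ≥0∞, Measurable L ∧
      Q.sampleLaw P' k = (Q.sampleLaw P k).withDensity L ∧
      ∫⁻ z, L z ^ 2 ∂(Q.sampleLaw P k) ≤ (1 + δ ^ 2) ^ k := by
  induction k with
  | zero =>
    refine ⟨fun _ => 1, measurable_const, ?_, ?_⟩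
    · exact withDensity_one.symm
    · simp
  | succ k ih =>
    obtain ⟨L, hL, hdens, hL2⟩ := ih (by omega)
    have : IsProbabilityMeasure ((Q.sampleLaw P k).withDensity L) := by
      rw [← hdens]; infer_instance
    obtain ⟨L', hL', hdens', hL2'⟩ := exists_density_stepLaw (Q.kernel k) P P' (Q.sampleLaw P k)
      hδ (h₁ k (by omega)) (h₂ k (by omega)) hL
      (ne_top_of_le_ne_top (by finiteness) hL2)
    refine ⟨L', hL', ?_, ?_⟩
    · rw [sampleLaw_succ, hdens, hdens']
      rfl
    · rw [sampleLaw_succ]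
      refine hL2'.trans ?_
      rw [mul_comm, pow_succ (1 + δ ^ 2)]
      exact mul_le_mul_left hL2 _

end Mechanism

/-! ### Privacy turns L¹ closeness of regression functions into closeness of released laws. -/

variable {d : ℕ}

theorem measurableSet_unitCube : MeasurableSet (unitCube d) := by
  have : unitCube d = ⋂ i, (fun x : Point d => x i) ⁻¹' Set.Icc (0 : ℝ) 1 := by
    ext x; simp [unitCube]
  rw [this]
  exact MeasurableSet.iInter fun i => measurableSet_Icc.preimage (by fun_prop)

/-- The volume of a coordinate cube. -/
theorem volume_cube (a b : Fin d → ℝ) :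
    volume {x : Point d | ∀ i, x i ∈ Set.Icc (a i) (b i)} = ∏ i, ENNReal.ofReal (b i - a i) := by
  have h : {x : Point d | ∀ i, x i ∈ Set.Icc (a i) (b i)} =
      (WithLp.ofLp : Point d → Fin d → ℝ) ⁻¹' Set.Icc a b := by
    ext x
    simp [Set.mem_Icc, Pi.le_def, forall_and]
  rw [h, (PiLp.volume_preserving_ofLp (Fin d)).measure_preimage measurableSet_Icc.nullMeasurableSet,
    Real.volume_Icc_pi]

theorem volume_unitCube : volume (unitCube d) = 1 := by
  have := volume_cube (fun _ : Fin d => (0 : ℝ)) (fun _ => 1)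
  simpa [unitCube] using this

instance : IsProbabilityMeasure (designLaw d) :=
  ⟨by simp [designLaw, volume_unitCube]⟩

instance : IsProbabilityMeasure noiseLaw :=
  ⟨by simp [noiseLaw, Real.volume_Icc]; norm_num⟩

theorem isProbabilityMeasure_rawLaw {m : Point d → ℝ} (hm : Measurable m) :
    IsProbabilityMeasure (rawLaw m) :=
  Measure.isProbabilityMeasure_map
    (by fun_prop : Measurable fun w : Point d × ℝ => (w.1, m w.1 + w.2)).aemeasurable

theorem lintegral_rawLaw {m : Point d → ℝ} (hm : Measurable m) {f : Point d × ℝ → ℝ≥0∞}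
    (hf : Measurable f) :
    ∫⁻ p, f p ∂(rawLaw m) =
      ∫⁻ x in unitCube d, ∫⁻ y in Set.Icc (m x - 1 / 2) (m x + 1 / 2), f (x, y) := by
  have hs : Measurable fun w : Point d × ℝ => (w.1, m w.1 + w.2) := by fun_prop
  have hfs : Measurable fun w : Point d × ℝ => f (w.1, m w.1 + w.2) := hf.comp hs
  rw [rawLaw, lintegral_map hf hs, lintegral_prod _ hfs.aemeasurable, designLaw, noiseLaw]
  refine lintegral_congr fun x => ?_
  have := (measurePreserving_add_left volume (m x)).setLIntegral_comp_preimage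
    (s := Set.Icc (m x - 1 / 2) (m x + 1 / 2)) measurableSet_Icc
    (f := fun y => f (x, y)) (hf.comp measurable_prodMk_left)
  rw [← this, Set.preimage_const_add_Icc]
  congr 3 <;> ring_nf

/-- Integrals over two unit intervals of a function that is nearly constant. -/
theorem setLIntegral_Icc_le {f : ℝ → ℝ≥0∞} {q ε : ℝ≥0∞} (a b : ℝ)
    (hq : ∀ y, y ∈ Set.Icc (a - 1 / 2) (a + 1 / 2) → q ≤ f y)
    (hε : ∀ y, y ∈ Set.Icc (b - 1 / 2) (b + 1 / 2) → f y ≤ (1 + ε) * q) :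
    ∫⁻ y in Set.Icc (b - 1 / 2) (b + 1 / 2), f y ≤
      (∫⁻ y in Set.Icc (a - 1 / 2) (a + 1 / 2), f y) + ε * q * ENNReal.ofReal |a - b| := by
  set I := Set.Icc (a - 1 / 2) (a + 1 / 2)
  set J := Set.Icc (b - 1 / 2) (b + 1 / 2)
  have hI : MeasurableSet I := measurableSet_Icc
  have hJ : MeasurableSet J := measurableSet_Icc
  -- Equal lengths let the contribution `q` on `J \ I` cancel against the one on `I \ J`, leaving
  -- only the excess `ε * q`.
  have hvol : volume (J \ I) = volume (I \ J) := by
    have h1 := measure_inter_add_sdiff (μ := volume) I hJ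
    have h2 := measure_inter_add_sdiff (μ := volume) J hI
    have h3 : volume I = volume J := by simp [I, J, Real.volume_Icc]
    rw [Set.inter_comm, ← h3, ← h1] at h2
    refine (ENNReal.add_right_inj ?_).1 h2
    exact ne_top_of_le_ne_top (by simp [I, Real.volume_Icc])
      (measure_mono (Set.inter_subset_left (s := I) (t := J)))
  have hle : volume (J \ I) ≤ ENNReal.ofReal |a - b| := by
    rcases le_total a b with h | h
    · calc volume (J \ I) ≤ volume (Set.Ioc (a + 1 / 2) (b + 1 / 2)) := by
            refine measure_mono fun y hy => ?_
            simp only [I, J, Set.mem_sdiff, Set.mem_Icc, not_and_or, not_le] at hy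
            obtain ⟨hy1, hy2 | hy2⟩ := hy
            · linarith
            · exact ⟨hy2, hy1.2⟩
        _ = _ := by
            rw [Real.volume_Ioc, abs_sub_comm, abs_of_nonneg (by linarith)]
            ring_nf
    · calc volume (J \ I) ≤ volume (Set.Ico (b - 1 / 2) (a - 1 / 2)) := by
            refine measure_mono fun y hy => ?_
            simp only [I, J, Set.mem_sdiff, Set.mem_Icc, not_and_or, not_le] at hy
            obtain ⟨hy1, hy2 | hy2⟩ := hy
            · exact ⟨hy1.1, hy2⟩
            · linarith
        _ = _ := by
            rw [Real.volume_Ico, abs_of_nonneg (by linarith)]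
            ring_nf
  have hJI : ∫⁻ y in J \ I, f y ≤ (1 + ε) * q * volume (J \ I) := by
    rw [← setLIntegral_const]
    exact setLIntegral_mono' (hJ.diff hI) fun y hy => hε y hy.1
  have hIJ : q * volume (J \ I) ≤ ∫⁻ y in I \ J, f y := by
    rw [hvol, ← setLIntegral_const]
    exact setLIntegral_mono' (hI.diff hJ) fun y hy => hq y hy.1
  rw [← lintegral_inter_add_sdiff f J hI, ← lintegral_inter_add_sdiff f I hJ, Set.inter_comm J I]
  calc (∫⁻ y in I ∩ J, f y) + ∫⁻ y in J \ I, f y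
      ≤ (∫⁻ y in I ∩ J, f y) + (q * volume (J \ I) + ε * q * volume (J \ I)) := by
        gcongr
        refine hJI.trans (le_of_eq ?_)
        ring
    _ ≤ (∫⁻ y in I ∩ J, f y) + ((∫⁻ y in I \ J, f y) + ε * q * ENNReal.ofReal |a - b|) := by
        gcongr
    _ = _ := by rw [add_assoc]

/-- A function whose values on the potential raw data agree up to the factor `1 + ε` has nearly
equal integrals under the raw laws of two regression functions that are close in `L¹`. The error
is relative to the infimum of `f`, hence to its integral under any raw law. -/
theorem lintegral_rawLaw_le {β C M : ℝ} {m m' m₀ : Point d → ℝ}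
    (hm : Measurable m) (hm' : Measurable m') (hm₀ : Measurable m₀)
    (hmem : m ∈ holderClass d β C M) (hmem' : m' ∈ holderClass d β C M)
    (hmem₀ : m₀ ∈ holderClass d β C M)
    {ε τ : ℝ≥0∞} (hε : ε ≠ ∞)
    (hτ : ∫⁻ x in unitCube d, ENNReal.ofReal |m x - m' x| ≤ τ)
    {f : Point d × ℝ → ℝ≥0∞} (hf : Measurable f)
    (hfD : ∀ p ∈ potentialValues d β C M, ∀ p' ∈ potentialValues d β C M,
      f p ≤ (1 + ε) * f p') :
    ∫⁻ p, f p ∂(rawLaw m') ≤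
      ∫⁻ p, f p ∂(rawLaw m) + ε * τ * ∫⁻ p, f p ∂(rawLaw m₀) := by
  set D := potentialValues d β C M
  have hD : ∀ g ∈ holderClass d β C M, ∀ x ∈ unitCube d,
      ∀ y ∈ Set.Icc (g x - 1 / 2) (g x + 1 / 2), (x, y) ∈ D := fun g hg x hx y hy => by
    refine ⟨hx, g, hg, ?_⟩
    rw [abs_le]
    constructor <;> simp only <;> linarith [hy.1, hy.2]
  set q := ⨅ p ∈ D, f p
  have hq : ∀ p ∈ D, q ≤ f p := fun p hp => iInf₂_le p hp
  have hfq : ∀ p ∈ D, f p ≤ (1 + ε) * q := fun p hp => by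
    have h0 : 1 + ε ≠ 0 := by simp
    have ht : 1 + ε ≠ ∞ := by finiteness
    rw [mul_comm, ← ENNReal.div_le_iff h0 ht]
    refine le_iInf₂ fun p' hp' => ?_
    rw [ENNReal.div_le_iff h0 ht, mul_comm]
    exact hfD p hp p' hp'
  have hq₀ : q ≤ ∫⁻ p, f p ∂(rawLaw m₀) := by
    rw [lintegral_rawLaw hm₀ hf]
    calc q = ∫⁻ x in unitCube d, ∫⁻ y in Set.Icc (m₀ x - 1 / 2) (m₀ x + 1 / 2), q := by
          simp [Real.volume_Icc, volume_unitCube]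
          norm_num
      _ ≤ _ := setLIntegral_mono' measurableSet_unitCube fun x hx =>
          setLIntegral_mono' measurableSet_Icc fun y hy => hq _ (hD m₀ hmem₀ x hx y hy)
  rw [lintegral_rawLaw hm hf, lintegral_rawLaw hm' hf]
  have hdm : Measurable fun x => ENNReal.ofReal |m x - m' x| := by fun_prop
  calc _ ≤ ∫⁻ x in unitCube d, ((∫⁻ y in Set.Icc (m x - 1 / 2) (m x + 1 / 2), f (x, y)) +
          ε * q * ENNReal.ofReal |m x - m' x|) :=
        setLIntegral_mono' measurableSet_unitCube fun x hx =>
          setLIntegral_Icc_le (m x) (m' x) (fun y hy => hq _ (hD m hmem x hx y hy))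
            (fun y hy => hfq _ (hD m' hmem' x hx y hy))
    _ = (∫⁻ x in unitCube d, ∫⁻ y in Set.Icc (m x - 1 / 2) (m x + 1 / 2), f (x, y)) +
          ε * q * ∫⁻ x in unitCube d, ENNReal.ofReal |m x - m' x| := by
        rw [lintegral_add_right _ (hdm.const_mul _), lintegral_const_mul _ hdm]
    _ ≤ _ := by
        rw [mul_right_comm ε τ]
        gcongr

/-- By `1 + t ≤ exp t` the power is at most `e`; this supplies the 3 required in
`le_lintegral_add_lintegral`. -/
theorem one_add_sq_pow_le {δ : ℝ≥0∞} {n : ℕ} (h : n * δ ^ 2 ≤ 1) : (1 + δ ^ 2) ^ n ≤ 3 := by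
  rcases Nat.eq_zero_or_pos n with rfl | hn
  · simp
  have hδ : δ ≠ ∞ := by
    rintro rfl
    have : (n : ℝ≥0∞) ≠ 0 := by exact_mod_cast hn.ne'
    simp [ENNReal.mul_top this] at h
  lift δ to NNReal using hδ
  norm_cast at *
  rw [← NNReal.coe_le_coe] at *
  push_cast at *
  calc (1 + (δ : ℝ) ^ 2) ^ n ≤ (Real.exp ((δ : ℝ) ^ 2)) ^ n := by
        gcongr; rw [add_comm]; exact Real.add_one_le_exp _
    _ = Real.exp (n * (δ : ℝ) ^ 2) := by rw [← Real.exp_nat_mul]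
    _ ≤ Real.exp 1 := Real.exp_le_exp.2 h
    _ ≤ 3 := by linarith [Real.exp_one_lt_d9]

/-- Two regression functions that are close in `L¹` cannot be told apart from a private sample. -/
theorem Mechanism.IsLDP.two_point_bound {β C M : ℝ} {Q : Mechanism.{u} d} {n : ℕ} {α ε : ℝ≥0∞}
    (hQ : Q.IsLDP (potentialValues d β C M) n α) (hα : EReal.exp (α : EReal) = 1 + ε)
    (hε : ε ≠ ∞) {m m' : Point d → ℝ} (hm : Measurable m) (hm' : Measurable m')
    (hmem : m ∈ holderClass d β C M) (hmem' : m' ∈ holderClass d β C M) {τ : ℝ≥0∞}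
    (hτt : τ ≠ ∞) (hτ : ∫⁻ x in unitCube d, ENNReal.ofReal |m x - m' x| ≤ τ)
    (hn : n * (ε * τ) ^ 2 ≤ 1) {f g : History Q.Out n → ℝ≥0∞} (hf : Measurable f)
    (hg : Measurable g) {Δ : ℝ≥0∞} (hfg : ∀ z, Δ ≤ f z + g z) :
    Δ ≤ 4 * (∫⁻ z, f z ∂(Q.sampleLaw (rawLaw m) n) +
      ∫⁻ z, g z ∂(Q.sampleLaw (rawLaw m') n)) := by
  have := isProbabilityMeasure_rawLaw hm
  have := isProbabilityMeasure_rawLaw hm'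
  have hmeas : ∀ k (z : History Q.Out k) (B : Set (Q.Out k)), MeasurableSet B →
      Measurable fun p => Q.kernel k (p, z) B := fun k z B hB =>
    ((Q.kernel k).measurable_coe hB).comp measurable_prodMk_right
  have hD : ∀ k < n, ∀ (z : History Q.Out k) (B : Set (Q.Out k)), MeasurableSet B →
      ∀ p ∈ potentialValues d β C M, ∀ p' ∈ potentialValues d β C M,
        Q.kernel k (p, z) B ≤ (1 + ε) * Q.kernel k (p', z) B :=
    fun k hk z B hB p hp p' hp' => by
      have h := hQ k hk p hp p' hp' z B hB
      rw [hα] at h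
      -- With a null denominator the ratio is `0` or `∞`; the finite bound `1 + ε` forces the
      -- numerator to vanish too.
      rcases eq_or_ne (Q.kernel k (p', z) B) 0 with h0 | h0
      · rw [h0] at h ⊢
        rcases eq_or_ne (Q.kernel k (p, z) B) 0 with h1 | h1
        · simp [h1]
        · rw [ENNReal.div_zero h1, top_le_iff] at h
          exact absurd h (by finiteness)
      · exact (ENNReal.div_le_iff h0 (measure_ne_top _ _)).1 h
  have hτ' : ∫⁻ x in unitCube d, ENNReal.ofReal |m' x - m x| ≤ τ := by
    simpa only [abs_sub_comm] using hτ
  -- The error is measured relative to the law under `m` in both directions, hence the reference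
  -- function `m₀` is `m` both times.
  obtain ⟨L, hL, hdens, hL2⟩ := Q.exists_density_sampleLaw (rawLaw m) (rawLaw m')
    (δ := ε * τ) (by finiteness) (n := n)
    (fun k hk z B hB => lintegral_rawLaw_le hm hm' hm hmem hmem' hmem hε hτ (hmeas k z B hB)
      (hD k hk z B hB))
    (fun k hk z B hB => lintegral_rawLaw_le hm' hm hm hmem' hmem hmem hε hτ' (hmeas k z B hB)
      (hD k hk z B hB)) le_rfl
  have : IsProbabilityMeasure ((Q.sampleLaw (rawLaw m) n).withDensity L) := by
    rw [← hdens]; infer_instance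
  rw [hdens]
  exact le_lintegral_add_lintegral hL (hL2.trans (one_add_sq_pow_le hn)) hf hg hfg

theorem abs_rpow_sub_rpow_le {β s t : ℝ} (hβ0 : 0 < β) (hβ1 : β ≤ 1) (hs : 0 ≤ s) (ht : 0 ≤ t) :
    |s ^ β - t ^ β| ≤ |s - t| ^ β := by
  wlog h : t ≤ s generalizing s t
  · rw [abs_sub_comm, abs_sub_comm s]
    exact this ht hs (le_of_not_ge h)
  have h1 : s ^ β ≤ t ^ β + (s - t) ^ β := by
    calc s ^ β = (t + (s - t)) ^ β := by ring_nf
      _ ≤ _ := Real.rpow_add_le_add_rpow ht (sub_nonneg.2 h) hβ0.le hβ1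
  have h2 : t ^ β ≤ s ^ β := Real.rpow_le_rpow ht h hβ0.le
  rw [abs_of_nonneg (by linarith), abs_of_nonneg (by linarith)]
  linarith

/-! ### The hypercube of Hölder bumps. -/

section Bump

variable {d k : ℕ}

/-- The centre of the cell with index `j` in the partition of the unit cube into `k ^ d` cells. -/
def cellCenter (j : Fin d → Fin k) : Fin d → ℝ := fun i => ((j i : ℝ) + 1 / 2) / k

/-- The points at sup-distance less than `1 / (2 * k)` from the centre of the cell. -/
def cell (j : Fin d → Fin k) : Set (Point d) :=
  {x | dist x.ofLp (cellCenter j) < 1 / (2 * k)}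

/-- The tent function of a cell, raised to the power `β`. -/
def bump (β : ℝ) (j : Fin d → Fin k) (x : Point d) : ℝ :=
  max 0 (1 / (2 * k) - dist x.ofLp (cellCenter j)) ^ β

theorem continuous_dist_cellCenter (j : Fin d → Fin k) :
    Continuous fun x : Point d => dist x.ofLp (cellCenter j) := by
  fun_prop

theorem measurableSet_cell (j : Fin d → Fin k) : MeasurableSet (cell j) :=
  measurableSet_lt (continuous_dist_cellCenter j).measurable measurable_const

theorem cell_subset_unitCube (j : Fin d → Fin k) : cell j ⊆ unitCube d := by
  intro x hx i
  have hk : (0 : ℝ) < k := by exact_mod_cast (j i).pos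
  have h1 : |x i - ((j i : ℝ) + 1 / 2) / k| < 1 / (2 * k) :=
    (dist_le_pi_dist x.ofLp (cellCenter j) i).trans_lt hx
  have h2 : ((j i : ℕ) : ℝ) + 1 ≤ k := by exact_mod_cast (j i).isLt
  have h3 : (0 : ℝ) ≤ (j i : ℕ) := by positivity
  have h4 : 1 / (2 * (k : ℝ)) * k = 1 / 2 := by field_simp
  have h5 : ((j i : ℝ) + 1 / 2) / k * k = (j i : ℝ) + 1 / 2 := by field_simp
  rw [abs_lt] at h1
  constructor
  · by_contra! h
    nlinarith
  · by_contra! h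
    nlinarith

/-- The cells are open boxes of side `1/k` around grid centres, so in each coordinate the two
integer indices differ by less than one. -/
theorem eq_of_mem_cell {j j' : Fin d → Fin k} {x : Point d} (h : x ∈ cell j) (h' : x ∈ cell j') :
    j = j' := by
  ext i
  have hk : (0 : ℝ) < k := by exact_mod_cast (j i).pos
  have h1 : |x i - ((j i : ℝ) + 1 / 2) / k| < 1 / (2 * k) :=
    (dist_le_pi_dist x.ofLp (cellCenter j) i).trans_lt h
  have h2 : |x i - ((j' i : ℝ) + 1 / 2) / k| < 1 / (2 * k) :=
    (dist_le_pi_dist x.ofLp (cellCenter j') i).trans_lt h'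
  have h3 : |((j i : ℕ) : ℝ) - (j' i : ℕ)| < 1 := by
    have e : ((j i : ℕ) : ℝ) - (j' i : ℕ) =
        k * ((x i - ((j' i : ℝ) + 1 / 2) / k) - (x i - ((j i : ℝ) + 1 / 2) / k)) := by
      field_simp; ring
    have e2 : (k : ℝ) * (1 / (2 * k) + 1 / (2 * k)) = 1 := by field_simp; norm_num
    rw [e, abs_mul, abs_of_pos hk]
    refine (mul_lt_mul_of_pos_left ((abs_sub _ _).trans_lt ?_) hk).trans_eq e2
    exact add_lt_add h2 h1
  have h4 : |((j i : ℕ) : ℤ) - (j' i : ℕ)| < 1 := by exact_mod_cast h3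
  rw [Int.abs_lt_one_iff] at h4
  omega

theorem bump_nonneg (β : ℝ) (j : Fin d → Fin k) (x : Point d) : 0 ≤ bump β j x :=
  Real.rpow_nonneg (le_max_left _ _) _

theorem bump_eq_zero {β : ℝ} (hβ : 0 < β) {j : Fin d → Fin k} {x : Point d} (hx : x ∉ cell j) :
    bump β j x = 0 := by
  have : 1 / (2 * (k : ℝ)) ≤ dist x.ofLp (cellCenter j) := not_lt.1 hx
  rw [bump, max_eq_left (by linarith), Real.zero_rpow hβ.ne']

theorem bump_le {β : ℝ} (hβ : 0 < β) (j : Fin d → Fin k) (x : Point d) :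
    bump β j x ≤ (1 / (2 * k)) ^ β := by
  refine Real.rpow_le_rpow (le_max_left _ _) (max_le (by positivity) ?_) hβ.le
  linarith [dist_nonneg (x := x.ofLp) (y := cellCenter j)]

theorem le_bump {β : ℝ} (hβ : 0 < β) {j : Fin d → Fin k} {x : Point d}
    (hx : dist x.ofLp (cellCenter j) ≤ 1 / (4 * k)) : (1 / (4 * k)) ^ β ≤ bump β j x := by
  refine Real.rpow_le_rpow (by positivity) (le_max_of_le_right ?_) hβ.le
  have : 1 / (2 * (k : ℝ)) = 1 / (4 * k) + 1 / (4 * k) := by ring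
  linarith

/-- The tent is 1-Lipschitz for the sup norm, hence for the larger Euclidean norm, and `t ↦ t ^ β`
is β-Hölder with constant one. -/
theorem abs_bump_sub_le {β : ℝ} (hβ0 : 0 < β) (hβ1 : β ≤ 1) (j : Fin d → Fin k) (x x' : Point d) :
    |bump β j x - bump β j x'| ≤ ‖x - x'‖ ^ β := by
  refine (abs_rpow_sub_rpow_le hβ0 hβ1 (le_max_left _ _) (le_max_left _ _)).trans ?_
  refine Real.rpow_le_rpow (abs_nonneg _) ?_ hβ0.le
  refine (abs_max_sub_max_le_max _ _ _ _).trans (max_le (by simp) ?_)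
  rw [sub_sub_sub_cancel_left, abs_sub_comm]
  refine (abs_dist_sub_le _ _ _).trans ?_
  rw [dist_pi_le_iff (norm_nonneg _)]
  intro i
  have := PiLp.norm_apply_le (x - x') i
  simpa [Real.dist_eq] using this

theorem measurable_bump (β : ℝ) (j : Fin d → Fin k) : Measurable (bump β j) := by
  have := (continuous_dist_cellCenter j).measurable
  unfold bump
  fun_prop

/-- The superposition of the bumps selected by `ν`. -/
def bumpSum (a β : ℝ) (ν : (Fin d → Fin k) → Bool) (x : Point d) : ℝ :=
  ∑ j, if ν j then a * bump β j x else 0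

theorem measurable_bumpSum (a β : ℝ) (ν : (Fin d → Fin k) → Bool) :
    Measurable (bumpSum a β ν) := by
  refine Finset.measurable_sum _ fun j _ => ?_
  split_ifs
  · exact (measurable_bump β j).const_mul a
  · exact measurable_const

theorem bumpSum_of_mem_cell {a β : ℝ} (hβ : 0 < β) (ν : (Fin d → Fin k) → Bool)
    {j : Fin d → Fin k} {x : Point d} (hx : x ∈ cell j) :
    bumpSum a β ν x = if ν j then a * bump β j x else 0 := by
  refine Finset.sum_eq_single j (fun j' _ hj' => ?_) (fun h => absurd (Finset.mem_univ j) h)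
  rw [bump_eq_zero hβ fun h => hj' (eq_of_mem_cell h hx)]
  simp

theorem bumpSum_of_forall_notMem {a β : ℝ} (hβ : 0 < β) (ν : (Fin d → Fin k) → Bool)
    {x : Point d} (hx : ∀ j : Fin d → Fin k, x ∉ cell j) : bumpSum a β ν x = 0 :=
  Finset.sum_eq_zero fun j _ => by simp [bump_eq_zero hβ (hx j)]

/-- Two points meet at most two cells, so at most two bumps contribute to a difference; this is the
factor in `2 * a ≤ C`. -/
theorem bumpSum_mem_holderClass {a β C M : ℝ} (hβ0 : 0 < β) (hβ1 : β ≤ 1) (ha : 0 ≤ a)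
    (haC : 2 * a ≤ C) (haM : a ≤ M) (hk : 1 ≤ k) (ν : (Fin d → Fin k) → Bool) :
    bumpSum a β ν ∈ holderClass d β C M := by
  have hk' : (1 : ℝ) ≤ k := by exact_mod_cast hk
  refine ⟨fun x x' => ?_, fun x hx => ?_, fun x => ?_⟩
  · classical
    have hex : ∀ y : Point d, ∃ s : Finset (Fin d → Fin k), s.card ≤ 1 ∧
        ∀ j, y ∈ cell j → j ∈ s := fun y => by
      by_cases h : ∃ j : Fin d → Fin k, y ∈ cell j
      · obtain ⟨j, hj⟩ := h
        exact ⟨{j}, by simp, fun j' hj' => by simp [eq_of_mem_cell hj' hj]⟩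
      · push Not at h
        exact ⟨∅, by simp, fun j hj => absurd hj (h j)⟩
    obtain ⟨s, hs, hs'⟩ := hex x
    obtain ⟨t, ht, ht'⟩ := hex x'
    have hcard : ((s ∪ t).card : ℝ) ≤ 2 := by
      exact_mod_cast (Finset.card_union_le s t).trans (by omega)
    have hnn : 0 ≤ a * ‖x - x'‖ ^ β := by positivity
    calc |bumpSum a β ν x - bumpSum a β ν x'|
        = |∑ j, if ν j then a * (bump β j x - bump β j x') else 0| := by
          rw [bumpSum, bumpSum, ← Finset.sum_sub_distrib]
          congr 1
          refine Finset.sum_congr rfl fun j _ => ?_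
          split_ifs <;> ring
      _ ≤ ∑ j, |if ν j then a * (bump β j x - bump β j x') else 0| :=
          Finset.abs_sum_le_sum_abs _ _
      _ = ∑ j ∈ s ∪ t, |if ν j then a * (bump β j x - bump β j x') else 0| := by
          refine (Finset.sum_subset (Finset.subset_univ _) fun j _ hj => ?_).symm
          rw [Finset.mem_union, not_or] at hj
          rw [bump_eq_zero hβ0 fun h => hj.1 (hs' j h), bump_eq_zero hβ0 fun h => hj.2 (ht' j h)]
          simp
      _ ≤ (s ∪ t).card • (a * ‖x - x'‖ ^ β) := by
          refine Finset.sum_le_card_nsmul _ _ _ fun j _ => ?_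
          split_ifs
          · rw [abs_mul, abs_of_nonneg ha]
            exact mul_le_mul_of_nonneg_left (abs_bump_sub_le hβ0 hβ1 j x x') ha
          · simpa using hnn
      _ ≤ 2 * (a * ‖x - x'‖ ^ β) := by
          rw [nsmul_eq_mul]
          exact mul_le_mul_of_nonneg_right hcard hnn
      _ ≤ C * ‖x - x'‖ ^ β := by
          rw [← mul_assoc]
          gcongr
  · by_contra h
    exact hx (bumpSum_of_forall_notMem hβ0 ν fun j hj => h (cell_subset_unitCube j hj))
  · by_cases h : ∃ j : Fin d → Fin k, x ∈ cell j
    · obtain ⟨j, hj⟩ := h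
      rw [bumpSum_of_mem_cell hβ0 ν hj]
      split_ifs
      · rw [abs_of_nonneg (mul_nonneg ha (bump_nonneg _ _ _))]
        have h1 : bump β j x ≤ 1 := by
          refine (bump_le hβ0 j x).trans (Real.rpow_le_one (by positivity) ?_ hβ0.le)
          rw [div_le_one (by positivity)]
          linarith
        nlinarith
      · simpa using ha.trans haM
    · push Not at h
      rw [bumpSum_of_forall_notMem hβ0 ν h]
      simpa using ha.trans haM

theorem volume_setOf_dist_le (j : Fin d → Fin k) {r : ℝ} (hr : 0 ≤ r) :
    volume {x : Point d | dist x.ofLp (cellCenter j) ≤ r} = ENNReal.ofReal ((2 * r) ^ d) := by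
  have h : {x : Point d | dist x.ofLp (cellCenter j) ≤ r} =
      {x | ∀ i, x i ∈ Set.Icc (cellCenter j i - r) (cellCenter j i + r)} := by
    ext x
    simp only [Set.mem_ofPred_eq, dist_pi_le_iff hr, Real.dist_eq, abs_le, Set.mem_Icc]
    refine forall_congr' fun i => ⟨fun h => ⟨?_, ?_⟩, fun h => ⟨?_, ?_⟩⟩ <;> linarith [h.1, h.2]
  rw [h, volume_cube, ENNReal.ofReal_pow (by positivity)]
  simp [two_mul]

/-- Only the flipped bump survives: its height is at most `k^(-β)` and its cell has volume at most
`k^(-d)`. -/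
theorem lintegral_abs_bumpSum_update_le {a β : ℝ} (hβ : 0 < β) (ha0 : 0 ≤ a) (ha1 : a ≤ 1)
    (hk : 1 ≤ k) (ν : (Fin d → Fin k) → Bool) (j : Fin d → Fin k) :
    ∫⁻ x in unitCube d, ENNReal.ofReal
      |bumpSum a β ν x - bumpSum a β (Function.update ν j (!ν j)) x| ≤
      ENNReal.ofReal ((k : ℝ) ^ (-(β + d))) := by
  have hk' : (0 : ℝ) < k := by exact_mod_cast hk
  have hdiff : ∀ x, |bumpSum a β ν x - bumpSum a β (Function.update ν j (!ν j)) x| =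
      a * bump β j x := fun x => by
    rw [bumpSum, bumpSum, ← Finset.sum_sub_distrib, Finset.sum_eq_single j]
    · rw [Function.update_self]
      have := mul_nonneg ha0 (bump_nonneg β j x)
      cases ν j <;> simp [abs_of_nonneg this, -abs_mul]
    · intro j' _ hj'
      rw [Function.update_of_ne hj', sub_self]
    · exact fun h => absurd (Finset.mem_univ j) h
  simp_rw [hdiff]
  calc ∫⁻ x in unitCube d, ENNReal.ofReal (a * bump β j x)
      ≤ ∫⁻ x, ENNReal.ofReal (a * bump β j x) := setLIntegral_le_lintegral _ _
    _ = ∫⁻ x in cell j, ENNReal.ofReal (a * bump β j x) := by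
        refine (setLIntegral_eq_of_support_subset fun x hx => ?_).symm
        by_contra h
        exact hx (by simp [bump_eq_zero hβ h])
    _ ≤ ∫⁻ x in cell j, ENNReal.ofReal ((1 / (2 * k)) ^ β) := by
        refine lintegral_mono fun x => ENNReal.ofReal_le_ofReal ?_
        exact (mul_le_of_le_one_left (bump_nonneg _ _ _) ha1).trans (bump_le hβ j x)
    _ ≤ ENNReal.ofReal ((1 / (2 * k)) ^ β) * ENNReal.ofReal ((2 * (1 / (2 * k))) ^ d) := by
        rw [setLIntegral_const, ← volume_setOf_dist_le j (by positivity : 0 ≤ 1 / (2 * (k : ℝ)))]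
        gcongr
        exact fun x (hx : dist x.ofLp (cellCenter j) < _) => hx.le
    _ ≤ _ := by
        rw [← ENNReal.ofReal_mul (by positivity)]
        refine ENNReal.ofReal_le_ofReal ?_
        have e : 2 * (1 / (2 * (k : ℝ))) = (k : ℝ)⁻¹ := by field_simp
        rw [e, neg_add, Real.rpow_add hk', Real.rpow_neg hk'.le, Real.rpow_neg hk'.le,
          Real.rpow_natCast, inv_pow, ← Real.inv_rpow hk'.le]
        gcongr
        rw [one_div]
        gcongr
        linarith

/-- The bump of a cell and the zero function are separated in `L²` of the cell. -/
theorem le_lintegral_cell_add {a β : ℝ} (hβ : 0 < β) (hk : 1 ≤ k)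
    (j : Fin d → Fin k) {h : Point d → ℝ} (hh : Measurable h) (b : Bool) :
    ENNReal.ofReal (a ^ 2 / 2 * (1 / 4) ^ (2 * β) * (1 / 2) ^ d * (k : ℝ) ^ (-(2 * β)) /
        (k : ℝ) ^ d) ≤
      (∫⁻ x in cell j, ENNReal.ofReal ((h x - if b then a * bump β j x else 0) ^ 2)) +
        ∫⁻ x in cell j, ENNReal.ofReal ((h x - if !b then a * bump β j x else 0) ^ 2) := by
  have hk' : (0 : ℝ) < k := by exact_mod_cast hk
  have hb := measurable_bump β j
  rw [← lintegral_add_left (by cases b <;> simp <;> fun_prop)]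
  -- At half the cell radius the tent still has at least half its peak; this produces the factors
  -- `(1 / 4) ^ (2 * β)` and `(1 / 2) ^ d`.
  set r : ℝ := 1 / (4 * k) with hr
  have hsub : {x : Point d | dist x.ofLp (cellCenter j) ≤ r} ⊆ cell j := fun x (hx : dist x.ofLp _ ≤ r) => by
    refine lt_of_le_of_lt hx ?_
    rw [hr]
    gcongr
    norm_num
  have hms : MeasurableSet {x : Point d | dist x.ofLp (cellCenter j) ≤ r} :=
    measurableSet_le (continuous_dist_cellCenter j).measurable measurable_const
  calc _ = ∫⁻ x in {x : Point d | dist x.ofLp (cellCenter j) ≤ r},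
          ENNReal.ofReal (a ^ 2 / 2 * (r ^ β) ^ 2) := by
        rw [setLIntegral_const, volume_setOf_dist_le j (by positivity),
          ← ENNReal.ofReal_mul (by positivity)]
        congr 1
        have e1 : r = 1 / 4 * (k : ℝ)⁻¹ := by rw [hr]; field_simp
        have e2 : 2 * r = 1 / 2 * (k : ℝ)⁻¹ := by rw [e1]; ring
        have e3 : (r ^ β) ^ 2 = r ^ (2 * β) := by
          rw [mul_comm 2 β, Real.rpow_mul (by positivity), Real.rpow_ofNat]
        rw [e3, e2, e1, Real.mul_rpow (by positivity) (by positivity), mul_pow,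
          Real.rpow_neg hk'.le, Real.inv_rpow hk'.le, inv_pow, div_eq_mul_inv _ ((k : ℝ) ^ d)]
        ring
    _ ≤ ∫⁻ x in {x : Point d | dist x.ofLp (cellCenter j) ≤ r},
          (ENNReal.ofReal ((h x - if b then a * bump β j x else 0) ^ 2) +
            ENNReal.ofReal ((h x - if !b then a * bump β j x else 0) ^ 2)) := by
        refine setLIntegral_mono' hms fun x hx => ?_
        rw [← ENNReal.ofReal_add (by positivity) (by positivity)]
        refine ENNReal.ofReal_le_ofReal ?_
        have h1 : (r ^ β) ^ 2 ≤ bump β j x ^ 2 := by gcongr; exact le_bump hβ hx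
        have h2 : a ^ 2 / 2 * (r ^ β) ^ 2 ≤ a ^ 2 / 2 * bump β j x ^ 2 := by gcongr
        -- With `B` the scaled bump, `(h - B)² + h² ≥ B² / 2`, the gap being `(2h - B)² / 2`.
        cases b <;> simp <;> nlinarith [sq_nonneg (2 * h x - a * bump β j x)]
    _ ≤ _ := lintegral_mono_set hsub

end Bump

/-! ### Assouad's reduction and the choice of the number of bins. -/

/-- Assouad's averaging argument over the vertices of the hypercube. -/
theorem card_mul_le_of_hypercube {J : Type*} [Fintype J] [DecidableEq J]
    (e : J → (J → Bool) → ℝ≥0∞) {R Δ : ℝ≥0∞} (hR : ∀ ν, ∑ j, e j ν ≤ R)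
    (hΔ : ∀ j ν, Δ ≤ e j ν + e j (Function.update ν j (!ν j))) :
    Fintype.card J * Δ ≤ 2 * R := by
  -- Flipping coordinate `j` permutes the vertices, so both halves of each pair have the same total.
  have hflip : ∀ j, ∑ ν : J → Bool, e j (Function.update ν j (!ν j)) = ∑ ν, e j ν := fun j => by
    have hinv : Function.Involutive fun ν : J → Bool => Function.update ν j (!ν j) :=
      fun ν => by simp
    exact Equiv.sum_comp hinv.toPerm (e j)
  obtain ⟨N, hN⟩ : ∃ N : ℝ≥0∞, N = ((Fintype.card (J → Bool) : ℕ) : ℝ≥0∞) := ⟨_, rfl⟩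
  have hN0 : N ≠ 0 := by simp [hN]
  have hNt : N ≠ ∞ := hN ▸ ENNReal.natCast_ne_top _
  have key : N * (Fintype.card J * Δ) ≤ N * (2 * R) := by
    calc N * (Fintype.card J * Δ) = ∑ j : J, ∑ _ν : J → Bool, Δ := by
          simp only [Finset.sum_const, Finset.card_univ, nsmul_eq_mul, hN]
          ring
      _ ≤ ∑ j, ∑ ν, (e j ν + e j (Function.update ν j (!ν j))) :=
          Finset.sum_le_sum fun j _ => Finset.sum_le_sum fun ν _ => hΔ j ν
      _ = 2 * ∑ ν, ∑ j, e j ν := by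
          rw [Finset.sum_comm (s := (Finset.univ : Finset (J → Bool))), two_mul,
            ← Finset.sum_add_distrib]
          refine Finset.sum_congr rfl fun j _ => ?_
          rw [Finset.sum_add_distrib, hflip]
      _ ≤ 2 * ∑ _ν : J → Bool, R := by
          gcongr with ν
          exact hR ν
      _ = N * (2 * R) := by
          simp only [Finset.sum_const, Finset.card_univ, nsmul_eq_mul, hN]
          ring
  exact (ENNReal.mul_le_mul_iff_right hN0 hNt).1 key

/-- The private minimax risk is bounded below through a hypercube of `k ^ d` bumps, provided that
neighbouring vertices of the hypercube cannot be told apart. -/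
theorem le_minimaxRisk_of_bumps {a β C M : ℝ} (hβ0 : 0 < β) (hβ1 : β ≤ 1) (ha0 : 0 ≤ a)
    (ha1 : a ≤ 1) (haC : 2 * a ≤ C) (haM : a ≤ M) {n k : ℕ} (hk : 1 ≤ k) {α ε : ℝ≥0∞}
    (hα : EReal.exp (α : EReal) = 1 + ε) (hε : ε ≠ ∞)
    (hn : n * (ε * ENNReal.ofReal ((k : ℝ) ^ (-(β + d)))) ^ 2 ≤ 1) :
    ENNReal.ofReal (a ^ 2 / 2 * (1 / 4) ^ (2 * β) * (1 / 2) ^ d / 8 * (k : ℝ) ^ (-(2 * β))) ≤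
      minimaxRisk.{u} d β C M n α := by
  refine le_iInf₂ fun Q hQ => le_iInf₂ fun est hest => ?_
  set R := ⨆ m ∈ holderClass d β C M, Q.risk n est m
  have hk' : (0 : ℝ) < k := by exact_mod_cast hk
  -- On a cell the truth depends on `ν` only through `ν j`, so the loss there is a two-point
  -- problem.
  set loss : (Fin d → Fin k) → Bool → History Q.Out n → ℝ≥0∞ := fun j b z =>
    ∫⁻ x in cell j, ENNReal.ofReal ((est z x - if b then a * bump β j x else 0) ^ 2) with hloss
  have hlossm : ∀ j b, Measurable (loss j b) := fun j b => by
    have hb := measurable_bump β j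
    have h1 : Measurable fun q : History Q.Out n × Point d => est q.1 q.2 := hest
    have h2 : Measurable fun q : History Q.Out n × Point d =>
        ENNReal.ofReal ((est q.1 q.2 - if b then a * bump β j q.2 else 0) ^ 2) := by
      cases b <;> simp <;> fun_prop
    exact h2.lintegral_prod_right'
  have hR : ∀ ν, ∑ j, ∫⁻ z, loss j (ν j) z ∂(Q.sampleLaw (rawLaw (bumpSum a β ν)) n) ≤ R :=
    fun ν => by
      have hrisk : Q.risk n est (bumpSum a β ν) ≤ R :=
        le_iSup₂ (f := fun m (_ : m ∈ holderClass d β C M) => Q.risk n est m) _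
          (bumpSum_mem_holderClass hβ0 hβ1 ha0 haC haM hk ν)
      refine le_trans ?_ hrisk
      rw [← lintegral_finsetSum _ fun j _ => hlossm j (ν j)]
      refine lintegral_mono fun z => ?_
      calc ∑ j, loss j (ν j) z
          = ∑ j, ∫⁻ x in cell j, ENNReal.ofReal ((est z x - bumpSum a β ν x) ^ 2) := by
            refine Finset.sum_congr rfl fun j _ =>
              setLIntegral_congr_fun (measurableSet_cell j) fun x hx => ?_
            simp only [bumpSum_of_mem_cell hβ0 ν hx]
        _ = ∫⁻ x in ⋃ j ∈ (Finset.univ : Finset (Fin d → Fin k)), cell j,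
              ENNReal.ofReal ((est z x - bumpSum a β ν x) ^ 2) := by
            refine (lintegral_biUnion_finset (fun j _ j' _ hjj' => ?_)
              (fun j _ => measurableSet_cell j) _).symm
            exact Set.disjoint_left.2 fun x hx hx' => hjj' (eq_of_mem_cell hx hx')
        _ ≤ _ := lintegral_mono_set (Set.iUnion₂_subset fun j _ => cell_subset_unitCube j)
  -- The factor 4 of the testing bound is absorbed into the losses; with Assouad's 2 it makes the 8
  -- in the constant.
  have hΔ := card_mul_le_of_hypercube
    (fun j ν => 4 * ∫⁻ z, loss j (ν j) z ∂(Q.sampleLaw (rawLaw (bumpSum a β ν)) n))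
    (R := 4 * R)
    (Δ := ENNReal.ofReal (a ^ 2 / 2 * (1 / 4) ^ (2 * β) * (1 / 2) ^ d * (k : ℝ) ^ (-(2 * β)) /
        (k : ℝ) ^ d))
    (fun ν => by rw [← Finset.mul_sum]; gcongr; exact hR ν)
    (fun j ν => by
      rw [← mul_add, Function.update_self]
      exact hQ.two_point_bound hα hε (measurable_bumpSum a β ν) (measurable_bumpSum a β _)
        (bumpSum_mem_holderClass hβ0 hβ1 ha0 haC haM hk ν)
        (bumpSum_mem_holderClass hβ0 hβ1 ha0 haC haM hk _) ENNReal.ofReal_ne_top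
        (lintegral_abs_bumpSum_update_le hβ0 ha0 ha1 hk ν j) hn (hlossm j _) (hlossm j _)
        fun z => le_lintegral_cell_add hβ0 hk j (hest.comp measurable_prodMk_left) (ν j))
  have hcard : ((Fintype.card (Fin d → Fin k) : ℕ) : ℝ≥0∞) = ENNReal.ofReal ((k : ℝ) ^ d) := by
    rw [ENNReal.ofReal_pow hk'.le]
    simp
  rw [hcard, ← ENNReal.ofReal_mul (by positivity)] at hΔ
  have h8 : (2 : ℝ≥0∞) * (4 * R) = ENNReal.ofReal 8 * R := by
    rw [← mul_assoc]
    norm_num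
  rw [h8] at hΔ
  have h80 : ENNReal.ofReal 8 ≠ 0 := by simp
  refine (ENNReal.mul_le_mul_iff_right h80 ENNReal.ofReal_ne_top).1 (le_trans (le_of_eq ?_) hΔ)
  rw [← ENNReal.ofReal_mul (by norm_num)]
  congr 1
  field_simp

/-- The number of bins that balances separation against indistinguishability. -/
theorem exists_bin_count {β N : ℝ} (hβ : 0 < β) (hN : 0 ≤ N) :
    ∃ k : ℕ, 1 ≤ k ∧ N * ((k : ℝ) ^ (-(β + d))) ^ 2 ≤ 1 ∧
      (N ≤ 1 → (2 : ℝ) ^ (-(2 * β)) ≤ (k : ℝ) ^ (-(2 * β))) ∧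
      (1 ≤ N → (2 : ℝ) ^ (-(2 * β)) * N ^ (-(β / (β + d))) ≤ (k : ℝ) ^ (-(2 * β))) := by
  have hs : 0 < β + d := by positivity
  -- The second entry solves `N * x ^ (-2(β+d)) = 1`. The maximum with 1 gives `⌈x⌉₊ ≤ 2 * x`, so
  -- rounding costs only `2 ^ (-(2 * β))`.
  set x : ℝ := max 1 (N ^ (1 / (2 * (β + d))))
  have hx1 : 1 ≤ x := le_max_left _ _
  refine ⟨⌈x⌉₊, Nat.one_le_iff_ne_zero.2 (by positivity), ?_, ?_⟩
  · have hk : x ≤ ⌈x⌉₊ := Nat.le_ceil x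
    have hk0 : (0 : ℝ) < ⌈x⌉₊ := by linarith
    have h1 : N ≤ (⌈x⌉₊ : ℝ) ^ (2 * (β + d)) := by
      calc N = (N ^ (1 / (2 * (β + d)))) ^ (2 * (β + d)) := by
            rw [← Real.rpow_mul hN, one_div_mul_cancel (by positivity), Real.rpow_one]
        _ ≤ _ := by
            gcongr
            exact (le_max_right _ _).trans hk
    rw [← Real.rpow_natCast, ← Real.rpow_mul hk0.le]
    calc N * (⌈x⌉₊ : ℝ) ^ (-(β + d) * (2 : ℕ))
        ≤ (⌈x⌉₊ : ℝ) ^ (2 * (β + d)) * (⌈x⌉₊ : ℝ) ^ (-(β + d) * (2 : ℕ)) := by gcongr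
      _ = 1 := by
          rw [← Real.rpow_add hk0]
          push_cast
          ring_nf
          simp
  · have hk : (⌈x⌉₊ : ℝ) ≤ 2 * x := by
      linarith [Nat.ceil_lt_add_one (by linarith : 0 ≤ x)]
    have hk0 : (0 : ℝ) < ⌈x⌉₊ := by positivity
    have h2 : (2 : ℝ) ^ (-(2 * β)) * x ^ (-(2 * β)) ≤ (⌈x⌉₊ : ℝ) ^ (-(2 * β)) := by
      rw [← Real.mul_rpow (by norm_num) (by linarith)]
      exact Real.rpow_le_rpow_of_nonpos hk0 hk (by linarith)
    refine ⟨fun h => ?_, fun h => ?_⟩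
    · have : x = 1 := max_eq_left (Real.rpow_le_one hN h (by positivity))
      simpa [this] using h2
    · have hx : x = N ^ (1 / (2 * (β + d))) :=
        max_eq_right (Real.one_le_rpow h (by positivity))
      have he : x ^ (-(2 * β)) = N ^ (-(β / (β + d))) := by
        rw [hx, ← Real.rpow_mul hN]
        congr 1
        field_simp
      rwa [he] at h2

end PrivateRegression
end

theorem theorem4p1 (d : ℕ) (hd : 1 ≤ d) (β C M : ℝ) (hβ0 : 0 < β) (hβ1 : β ≤ 1)
    (hC : 0 < C) (hM : 0 < M) :
    ∃ c : ℝ, 0 < c ∧ ∀ (n : ℕ), 1 ≤ n → ∀ α : ℝ≥0∞,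
      ENNReal.ofReal c *
          min (((n : ℝ≥0∞) * (EReal.exp (α : EReal) - 1) ^ 2) ^ (-(β / (β + (d : ℝ))))) 1
        ≤ PrivateRegression.minimaxRisk.{u} d β C M n α := by
  -- The three entries serve the L¹ bound, the Hölder constant and the sup bound.
  set a : ℝ := min 1 (min (C / 2) M)
  have ha0 : 0 < a := by positivity
  have ha1 : a ≤ 1 := min_le_left _ _
  have haC : 2 * a ≤ C := by
    have : a ≤ C / 2 := (min_le_right _ _).trans (min_le_left _ _)
    linarith
  have haM : a ≤ M := (min_le_right _ _).trans (min_le_right _ _)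
  set c₀ : ℝ := a ^ 2 / 2 * (1 / 4) ^ (2 * β) * (1 / 2) ^ d / 8
  have hc₀ : 0 < c₀ := by positivity
  have hexp : 0 < β / (β + d) := by positivity
  refine ⟨c₀ * 2 ^ (-(2 * β)), by positivity, fun n hn α => ?_⟩
  have hn0 : (n : ℝ≥0∞) ≠ 0 := by exact_mod_cast (by omega : n ≠ 0)
  -- For `α = ∞` the claimed lower bound is zero, since `∞` to a negative power is `0`.
  rcases eq_or_ne α ∞ with rfl | hαt
  · simp [ENNReal.mul_top hn0, ENNReal.top_rpow_of_neg (neg_lt_zero.2 hexp)]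
  set ε : ℝ≥0∞ := EReal.exp (α : EReal) - 1
  have hone : 1 ≤ EReal.exp (α : EReal) := by
    rw [← EReal.exp_zero]
    exact EReal.exp_monotone (EReal.coe_ennreal_nonneg α)
  have hα : EReal.exp (α : EReal) = 1 + ε := (add_tsub_cancel_of_le hone).symm
  have hε : ε ≠ ∞ := by
    refine ne_top_of_le_ne_top ?_ tsub_le_self
    rw [Ne, EReal.exp_eq_top_iff]
    simpa using hαt
  obtain ⟨k, hk, hNk, hk₁, hk₂⟩ := PrivateRegression.exists_bin_count (d := d) hβ0
    (N := n * ε.toReal ^ 2) (by positivity)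
  have hN : (n : ℝ≥0∞) * ε ^ 2 = ENNReal.ofReal (n * ε.toReal ^ 2) := by
    rw [ENNReal.ofReal_mul (by positivity), ENNReal.ofReal_pow (by positivity),
      ENNReal.ofReal_toReal hε, ENNReal.ofReal_natCast]
  have hsmall : n * (ε * ENNReal.ofReal ((k : ℝ) ^ (-(β + d)))) ^ 2 ≤ 1 := by
    rw [mul_pow, ← mul_assoc, hN, ← ENNReal.ofReal_pow (by positivity),
      ← ENNReal.ofReal_mul (by positivity)]
    exact ENNReal.ofReal_le_one.2 hNk
  refine le_trans ?_ (PrivateRegression.le_minimaxRisk_of_bumps hβ0 hβ1 ha0.le ha1 haC haM hk hα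
    hε hsmall)
  rw [hN]
  -- The first case includes `α = 0`, where the power is `∞` and the minimum is 1.
  rcases le_total ((n : ℝ) * ε.toReal ^ 2) 1 with h | h
  · calc _ ≤ ENNReal.ofReal (c₀ * 2 ^ (-(2 * β))) * 1 := by gcongr; exact min_le_right _ _
      _ ≤ _ := by
        rw [mul_one]
        exact ENNReal.ofReal_le_ofReal (mul_le_mul_of_nonneg_left (hk₁ h) hc₀.le)
  · calc _ ≤ ENNReal.ofReal (c₀ * 2 ^ (-(2 * β))) *
          ENNReal.ofReal (n * ε.toReal ^ 2) ^ (-(β / (β + d))) := by gcongr; exact min_le_left _ _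
      _ ≤ _ := by
        rw [ENNReal.ofReal_rpow_of_pos (by linarith), ← ENNReal.ofReal_mul (by positivity),
          mul_assoc]
        exact ENNReal.ofReal_le_ofReal (mul_le_mul_of_nonneg_left (hk₂ h) hc₀.le)
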